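/- For a finite group $G$ and a subset $A\subseteq G$, let the VC-dimension of $A$ be the VC-dimension of the family of left translates of $A$, i.e., the largest integer $k\geq 0$ such that, for some $k$-element set $X\subseteq G$, every subset of $X$ is of the form $X\cap gA$ with $g\in G$. For any integer $d$ and any real $\epsilon>0$, there is an integer $n=n(d,\epsilon)$ such that, if $G$ is a nonabelian finite simple group of size greater than $n$, and $A\subseteq G$ has VC-dimension at most $d$, then $|A|\leq\epsilon|G|$ or $|A|\geq(1-\epsilon)|G|$. -/

import Mathlib

open scoped Pointwise in
/-- The family `{gA : g ∈ G}` of left translates of a subset `A` of a finite group `G`. -/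
def leftTranslates {G : Type*} [Group G] [Fintype G] [DecidableEq G] (A : Finset G) :
    Finset (Finset G) :=
  Finset.univ.image fun g : G => g • A

/-- The VC-dimension of a subset `A` of a finite group: the VC-dimension of its family of left
translates, i.e. the largest size of a set `X ⊆ G` with `𝒫(X) = {X ∩ gA : g ∈ G}`. -/
def groupVCDim {G : Type*} [Group G] [Fintype G] [DecidableEq G] (A : Finset G) : ℕ :=
  (leftTranslates A).vcDim

/-! The mechanism is quasirandomness. In a large nonabelian simple group every nontrivial real
representation has large dimension, by Jordan's commutator argument plus a packing bound. Hence for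
`f` of mean zero, the convolution operator `K` commutes with translations, the nonzero eigenvalues
of its Gram operator `K* K` have multiplicity at least `D`, and each is at most the trace over `D`.

So if `A` has density in `[ε, 1 - ε]`, then for any few sets `B i` some `x` splits each of them,
according to whether `x ∈ gA`, in nearly the expected proportion. Adding such points one at a time
gives a set of size `d + 1` shattered by the translates of `A`. -/

/-! ### Low-dimensional representations -/

/-- A nonabelian finite simple group with a nontrivial isometric representation on a real normed space
of dimension `n` has at most `5 ^ n ^ 2` elements: a nontrivial element closest to the identity, at
distance below `1 / 2`, would commute with all its conjugates, so the image is separated. -/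
theorem IsSimpleGroup.card_le_of_isometric_representation {G : Type*} [Group G] [Fintype G]
    [IsSimpleGroup G] (hG : ∃ a b : G, a * b ≠ b * a)
    {V : Type*} [NormedAddCommGroup V] [NormedSpace ℝ V] [FiniteDimensional ℝ V]
    (ρ : G →* (V →L[ℝ] V)) (hiso : ∀ g v, ‖ρ g v‖ = ‖v‖) (hne : ∃ g, ρ g ≠ 1) :
    Fintype.card G ≤ 5 ^ (Module.finrank ℝ V) ^ 2 := by
  classical
  have hnorm : ∀ g, ‖ρ g‖ ≤ 1 := fun g =>
    ContinuousLinearMap.opNorm_le_bound _ zero_le_one fun v => by rw [hiso, one_mul]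
  have hleft : ∀ g T, ‖ρ g * T‖ ≤ ‖T‖ := fun g T =>
    (norm_mul_le _ _).trans (by nlinarith [hnorm g, norm_nonneg T])
  have hright : ∀ g T, ‖T * ρ g‖ ≤ ‖T‖ := fun g T =>
    (norm_mul_le _ _).trans (by nlinarith [hnorm g, norm_nonneg T])
  have hker : ρ.ker = ⊥ := by
    refine (IsSimpleGroup.eq_bot_or_eq_top_of_normal ρ.ker inferInstance).resolve_right ?_
    intro h
    obtain ⟨g, hg⟩ := hne
    exact hg (ρ.mem_ker.1 (h ▸ Subgroup.mem_top g))
  have hinj : Function.Injective ρ := (MonoidHom.ker_eq_bot_iff ρ).1 hker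
  have hcenter : Subgroup.center G = ⊥ := by
    refine (IsSimpleGroup.eq_bot_or_eq_top_of_normal _ inferInstance).resolve_right ?_
    intro h
    obtain ⟨a, b, hab⟩ := hG
    exact hab ((Subgroup.mem_center_iff.1 (h ▸ Subgroup.mem_top b)) a)
  have hfar : ∀ g : G, g ≠ 1 → 1 / 2 ≤ ‖ρ g - 1‖ := by
    by_contra! hcon
    obtain ⟨g₀, hg₀, hlt₀⟩ := hcon
    obtain ⟨g, hg, hmin⟩ := Finset.exists_min_image (Finset.univ.filter fun g : G => g ≠ 1)
      (fun g => ‖ρ g - 1‖) ⟨g₀, by simpa using hg₀⟩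
    simp only [Finset.mem_filter, Finset.mem_univ, true_and] at hg hmin
    have hlt : ‖ρ g - 1‖ < 1 / 2 := (hmin g₀ hg₀).trans_lt hlt₀
    have hpos : 0 < ‖ρ g - 1‖ := by
      rw [norm_pos_iff, sub_ne_zero]
      exact fun h => hg (hinj (h.trans ρ.map_one.symm))
    have hcomm : ∀ h : G, g * (h * g * h⁻¹) = h * g * h⁻¹ * g := by
      intro h
      set k := h * g * h⁻¹ with hk
      have hkle : ‖ρ k - 1‖ ≤ ‖ρ g - 1‖ := by
        have : ρ k - 1 = ρ h * (ρ g - 1) * ρ h⁻¹ := by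
          rw [mul_sub, sub_mul, mul_one, ← map_mul, ← map_mul, ← map_mul, mul_inv_cancel, map_one]
        rw [this]
        exact (hright _ _).trans (hleft _ _)
      by_contra hne'
      have hc : g * k * (k * g)⁻¹ ≠ 1 := fun h' => hne' (mul_inv_eq_one.1 h')
      have h1 := hmin _ hc
      -- The commutator is quadratically close to the identity, hence closer than the minimal `g`.
      have h2 : ρ (g * k * (k * g)⁻¹) - 1
          = ((ρ g - 1) * (ρ k - 1) - (ρ k - 1) * (ρ g - 1)) * ρ (k * g)⁻¹ := by
        have h3 : (ρ g - 1) * (ρ k - 1) - (ρ k - 1) * (ρ g - 1) = ρ (g * k) - ρ (k * g) := by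
          rw [map_mul ρ g k, map_mul ρ k g]; noncomm_ring
        rw [h3, sub_mul, ← map_mul, ← map_mul, mul_inv_cancel, map_one]
      have h4 : ‖ρ (g * k * (k * g)⁻¹) - 1‖ ≤ 2 * (‖ρ g - 1‖ * ‖ρ k - 1‖) := by
        rw [h2]
        refine (hright _ _).trans ((norm_sub_le _ _).trans ?_)
        have e1 := norm_mul_le (ρ g - 1) (ρ k - 1)
        have e2 := norm_mul_le (ρ k - 1) (ρ g - 1)
        linarith [mul_comm ‖ρ g - 1‖ ‖ρ k - 1‖]
      nlinarith
    have hcl : Subgroup.normalClosure {g} = ⊤ := by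
      refine (IsSimpleGroup.eq_bot_or_eq_top_of_normal _ inferInstance).resolve_left ?_
      intro h
      have := Subgroup.subset_normalClosure (Set.mem_singleton g)
      rw [h] at this
      exact hg (Subgroup.mem_bot.1 this)
    have hle : Subgroup.normalClosure {g} ≤ Subgroup.centralizer {g} := by
      refine (Subgroup.closure_le _).2 fun x hx => ?_
      obtain ⟨y, hy, hyx⟩ := Group.mem_conjugatesOfSet_iff.1 hx
      obtain ⟨h, rfl⟩ := isConj_iff.1 hyx
      rw [Set.mem_singleton_iff] at hy
      subst hy
      rw [SetLike.mem_coe, Subgroup.mem_centralizer_singleton_iff]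
      exact (hcomm h).symm
    have hgc : g ∈ Subgroup.center G := Subgroup.mem_center_iff.2 fun x => by
      have : x ∈ Subgroup.centralizer {g} := hle (hcl ▸ Subgroup.mem_top x)
      exact Subgroup.mem_centralizer_singleton_iff.1 this
    rw [hcenter] at hgc
    exact hg (Subgroup.mem_bot.1 hgc)
  have hsep : ∀ g h : G, g ≠ h → 1 / 2 ≤ ‖ρ g - ρ h‖ := by
    intro g h hgh
    have h1 := hfar (g * h⁻¹) (fun h' => hgh (mul_inv_eq_one.1 h'))
    have h2 : ρ (g * h⁻¹) - 1 = (ρ g - ρ h) * ρ h⁻¹ := by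
      rw [sub_mul, ← map_mul, ← map_mul, mul_inv_cancel, map_one]
    rw [h2] at h1
    exact h1.trans (hright _ _)
  -- Doubling turns `1 / 2`-separation in the unit ball into the 1-separation in radius 2 that the
  -- packing bound needs.
  have hinj2 : Function.Injective fun g => (2 : ℝ) • ρ g := fun a b hab =>
    hinj (smul_right_injective _ two_ne_zero hab)
  have hcard := Besicovitch.card_le_of_separated (Finset.univ.image fun g => (2 : ℝ) • ρ g)
    (by
      intro c hc
      obtain ⟨g, -, rfl⟩ := Finset.mem_image.1 hc
      rw [norm_smul, Real.norm_ofNat]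
      linarith [hnorm g])
    (by
      intro c hc e he hce
      obtain ⟨g, -, rfl⟩ := Finset.mem_image.1 hc
      obtain ⟨h, -, rfl⟩ := Finset.mem_image.1 he
      rw [← smul_sub, norm_smul, Real.norm_ofNat]
      linarith [hsep g h (fun h' => hce (by rw [h']))])
  rw [Finset.card_image_of_injective _ hinj2, Finset.card_univ] at hcard
  have hdim : Module.finrank ℝ (V →L[ℝ] V) = (Module.finrank ℝ V) ^ 2 := by
    rw [← (LinearMap.toContinuousLinearMap (𝕜 := ℝ) (E := V) (F' := V)).finrank_eq,
      Module.finrank_linearMap, sq]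
  rwa [hdim] at hcard

/-! ### Spectral bound for convolution -/

open scoped InnerProductSpace in
/-- If every nonzero eigenvalue of a positive operator has multiplicity at least `D`, then the
quadratic form of the operator is at most its trace over `D`. -/
theorem LinearMap.IsPositive.mul_inner_le_trace_mul_norm_sq {E : Type*} [NormedAddCommGroup E]
    [InnerProductSpace ℝ E] [FiniteDimensional ℝ E] {T : E →ₗ[ℝ] E} (hT : T.IsPositive) {D : ℕ}
    (hD : ∀ μ : ℝ, μ ≠ 0 → Module.End.HasEigenvalue T μ →
      D ≤ Module.finrank ℝ (Module.End.eigenspace T μ)) (v : E) :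
    D * ⟪T v, v⟫_ℝ ≤ LinearMap.trace ℝ E T * ‖v‖ ^ 2 := by
  have hs := hT.isSymmetric
  have hn : Module.finrank ℝ E = Module.finrank ℝ E := rfl
  set l := hs.eigenvalues hn
  set b := hs.eigenvectorBasis hn
  have htr : LinearMap.trace ℝ E T = ∑ i, l i := by
    simpa using hs.trace_eq_sum_eigenvalues (hn := hn)
  have hnn : ∀ i, 0 ≤ l i := fun i => hT.nonneg_eigenvalues hn i
  have hle : ∀ i, D * l i ≤ ∑ j, l j := by
    intro i
    rcases eq_or_ne (l i) 0 with h0 | h0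
    · rw [h0, mul_zero]; exact Finset.sum_nonneg fun j _ => hnn j
    · have h1 := hD (l i) h0 (hs.hasEigenvalue_eigenvalues hn i)
      rw [← hs.card_filter_eigenvalues_eq hn] at h1
      calc D * l i ≤ ((Finset.univ.filter fun j => l j = l i).card : ℝ) * l i := by
            gcongr
            · exact hnn i
            · exact_mod_cast h1
        _ = ∑ j ∈ Finset.univ.filter fun j => l j = l i, l j := by
            rw [Finset.sum_congr rfl fun j hj => (Finset.mem_filter.1 hj).2]
            simp
        _ ≤ ∑ j, l j := Finset.sum_le_univ_sum_of_nonneg hnn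
  have h1 : ⟪T v, v⟫_ℝ = ∑ i, l i * ⟪b i, v⟫_ℝ ^ 2 := by
    rw [← b.sum_inner_mul_inner]
    refine Finset.sum_congr rfl fun i _ => ?_
    have hi : T (b i) = l i • b i := hs.apply_eigenvectorBasis hn i
    rw [hs, hi, real_inner_smul_right, real_inner_comm]
    ring
  have h2 : ‖v‖ ^ 2 = ∑ i, ⟪b i, v⟫_ℝ ^ 2 := by
    rw [← b.sum_sq_norm_inner_right]; simp
  rw [h1, h2, htr, Finset.mul_sum, Finset.mul_sum]
  refine Finset.sum_le_sum fun i _ => ?_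
  rw [← mul_assoc]
  exact mul_le_mul_of_nonneg_right (hle i) (sq_nonneg _)

/-- A nonzero translation-invariant space of mean-zero functions on a nonabelian finite simple group
has large dimension. -/
theorem IsSimpleGroup.card_le_of_invariant_submodule {G : Type*} [Group G] [Fintype G]
    [IsSimpleGroup G] (hG : ∃ a b : G, a * b ≠ b * a) (W : Submodule ℝ (EuclideanSpace ℝ G))
    (hW : ∀ h : G, ∀ w ∈ W, LinearIsometryEquiv.piLpCongrLeft 2 ℝ ℝ (Equiv.mulLeft h) w ∈ W)
    (hsum : ∀ w ∈ W, ∑ x, w x = 0) (hne : W ≠ ⊥) :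
    Fintype.card G ≤ 5 ^ (Module.finrank ℝ W) ^ 2 := by
  classical
  let L : G → EuclideanSpace ℝ G ≃ₗᵢ[ℝ] EuclideanSpace ℝ G := fun h =>
    LinearIsometryEquiv.piLpCongrLeft 2 ℝ ℝ (Equiv.mulLeft h)
  have hL : ∀ h w x, L h w x = w (h⁻¹ * x) := fun h w x => rfl
  let ρ : G →* (W →L[ℝ] W) :=
    { toFun := fun h =>
        LinearMap.toContinuousLinearMap ((L h).toLinearEquiv.toLinearMap.restrict (hW h))
      map_one' := by
        ext w x
        change L 1 w x = (w : EuclideanSpace ℝ G) x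
        rw [hL, inv_one, one_mul]
      map_mul' := fun g h => by
        ext w x
        change L (g * h) w x = L g (L h w) x
        rw [hL, hL, hL, mul_inv_rev, mul_assoc] }
  refine IsSimpleGroup.card_le_of_isometric_representation hG ρ
    (fun g v => (L g).norm_map v) ?_
  by_contra! hcon
  obtain ⟨w, hw, hw0⟩ := W.exists_mem_ne_zero_of_ne_bot hne
  -- Functions fixed by all translations are constant, so mean zero forces them to vanish.
  have hconst : ∀ x, w x = w 1 := by
    intro x
    have h1 : ρ x ⟨w, hw⟩ = ⟨w, hw⟩ := by rw [hcon x]; rfl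
    have h2 : L x w = w := congrArg Subtype.val h1
    have h3 : L x w x = w x := by rw [h2]
    rw [hL, inv_mul_cancel] at h3
    exact h3.symm
  have h0 := hsum w hw
  rw [Finset.sum_congr rfl fun x _ => hconst x, Finset.sum_const, smul_eq_zero] at h0
  have h1 : w 1 = 0 := h0.resolve_left (by simp)
  exact hw0 (by ext x; rw [hconst x, h1]; rfl)

open scoped InnerProductSpace in
/-- Quasirandomness of nonabelian finite simple groups: convolution with a mean-zero function has
small operator norm. -/
theorem IsSimpleGroup.mul_sum_sq_convolution_le {G : Type*} [Group G] [Fintype G]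
    [IsSimpleGroup G] (hG : ∃ a b : G, a * b ≠ b * a) {D : ℕ} (hD : 5 ^ D ^ 2 < Fintype.card G)
    (f b : G → ℝ) (hf : ∑ g, f g = 0) :
    D * ∑ x, (∑ g, f (g⁻¹ * x) * b g) ^ 2 ≤
      (Fintype.card G * ∑ g, f g ^ 2) * ∑ g, b g ^ 2 := by
  classical
  let L : G → EuclideanSpace ℝ G ≃ₗᵢ[ℝ] EuclideanSpace ℝ G := fun h =>
    LinearIsometryEquiv.piLpCongrLeft 2 ℝ ℝ (Equiv.mulLeft h)
  have hL : ∀ h w x, L h w x = w (h⁻¹ * x) := fun h w x => rfl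
  let K : EuclideanSpace ℝ G →ₗ[ℝ] EuclideanSpace ℝ G :=
    Matrix.toLpLin 2 2 (Matrix.of fun x g => f (g⁻¹ * x))
  have hK : ∀ w x, K w x = ∑ g, f (g⁻¹ * x) * w g := fun w x => rfl
  have hKL : ∀ h w, K (L h w) = L h (K w) := by
    intro h w
    ext x
    rw [hL, hK, hK]
    refine Fintype.sum_equiv (Equiv.mulLeft h⁻¹) _ _ fun g => ?_
    rw [hL, Equiv.coe_mulLeft]
    congr 2
    group
  have hshift : ∀ (F : G → ℝ) (g : G), ∑ x, F (g⁻¹ * x) = ∑ x, F x := fun F g =>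
    Fintype.sum_equiv (Equiv.mulLeft g⁻¹) _ _ fun x => rfl
  let c : EuclideanSpace ℝ G := WithLp.toLp 2 fun _ => 1
  have hKc : K c = 0 := by
    ext x
    rw [hK]
    change ∑ g, f (g⁻¹ * x) * 1 = 0
    rw [← hf]
    refine Fintype.sum_equiv ((Equiv.inv G).trans (Equiv.mulRight x)) _ _ fun g => ?_
    simp
  let P := LinearMap.adjoint K ∘ₗ K
  have hP : ∀ v w, ⟪P v, w⟫_ℝ = ⟪K v, K w⟫_ℝ := fun v w => K.adjoint_inner_left _ _
  have hPpos : P.IsPositive := K.isPositive_adjoint_comp_self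
  have hPL : ∀ h w, P (L h w) = L h (P w) := by
    intro h w
    refine ext_inner_right ℝ fun v => ?_
    obtain ⟨v, rfl⟩ := (L h).surjective v
    rw [hP, hKL, hKL, LinearIsometryEquiv.inner_map_map, LinearIsometryEquiv.inner_map_map, hP]
  have hmult : ∀ μ : ℝ, μ ≠ 0 → Module.End.HasEigenvalue P μ →
      D ≤ Module.finrank ℝ (Module.End.eigenspace P μ) := by
    intro μ hμ hev
    by_contra! hlt
    have hcard := IsSimpleGroup.card_le_of_invariant_submodule hG (Module.End.eigenspace P μ)
      (fun h w hw => by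
        rw [Module.End.mem_eigenspace_iff] at hw ⊢
        change P (L h w) = μ • L h w
        rw [hPL, hw, map_smul])
      -- As `P` is symmetric and kills constants, eigenvectors for `μ ≠ 0` are orthogonal to
      -- constants.
      (fun w hw => by
        rw [Module.End.mem_eigenspace_iff] at hw
        have h1 : ⟪P w, c⟫_ℝ = 0 := by rw [hP, hKc, inner_zero_right]
        rw [hw, real_inner_smul_left] at h1
        have h2 := (mul_eq_zero.1 h1).resolve_left hμ
        rw [PiLp.inner_apply] at h2
        simpa [c] using h2)
      hev
    have : 5 ^ (Module.finrank ℝ (Module.End.eigenspace P μ)) ^ 2 ≤ 5 ^ D ^ 2 := by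
      gcongr
      norm_num
    omega
  -- The trace is the squared Hilbert–Schmidt norm of `K`, and each column of `K` is a translate of
  -- `f`.
  have htr : LinearMap.trace ℝ _ P = Fintype.card G * ∑ g, f g ^ 2 := by
    rw [LinearMap.trace_eq_sum_inner P (EuclideanSpace.basisFun G ℝ)]
    have : ∀ g, ⟪EuclideanSpace.basisFun G ℝ g, P (EuclideanSpace.basisFun G ℝ g)⟫_ℝ
        = ∑ x, f x ^ 2 := by
      intro g
      rw [real_inner_comm, hP, real_inner_self_eq_norm_sq, EuclideanSpace.real_norm_sq_eq,
        ← hshift (fun x => f x ^ 2) g]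
      refine Finset.sum_congr rfl fun x _ => ?_
      rw [hK]
      simp
    rw [Finset.sum_congr rfl fun g _ => this g, Finset.sum_const, Finset.card_univ, nsmul_eq_mul]
  have hmain := hPpos.mul_inner_le_trace_mul_norm_sq hmult (WithLp.toLp 2 b)
  rw [hP, real_inner_self_eq_norm_sq, EuclideanSpace.real_norm_sq_eq,
    EuclideanSpace.real_norm_sq_eq, htr] at hmain
  exact hmain

/-! ### Mixing and shattering -/

/-- For finitely many sets `B i` some translate of `A` meets each of them in about the expected number
of elements. -/
theorem IsSimpleGroup.exists_forall_abs_card_sub_le {G ι : Type*} [Group G] [Fintype G]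
    [DecidableEq G] [IsSimpleGroup G] (hG : ∃ a b : G, a * b ≠ b * a) {D : ℕ}
    (hD : 5 ^ D ^ 2 < Fintype.card G) (A : Finset G) (I : Finset ι) (B : ι → Finset G) {η : ℝ}
    (hη : 0 ≤ η) (hη' : I.card ≤ D * η ^ 2) :
    ∃ x : G, ∀ i ∈ I, |(((B i).filter fun g => g⁻¹ * x ∈ A).card : ℝ) -
      A.card / Fintype.card G * (B i).card| ≤ η * Fintype.card G := by
  set N := (Fintype.card G : ℝ) with hN
  have hNpos : 0 < N := by rw [hN]; exact_mod_cast Fintype.card_pos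
  rcases Nat.eq_zero_or_pos D with h0 | hDpos
  · have : I = ∅ := by
      rw [h0, Nat.cast_zero, zero_mul] at hη'
      exact Finset.card_eq_zero.1 (by exact_mod_cast le_antisymm hη' (Nat.cast_nonneg _))
    exact ⟨1, by simp [this]⟩
  set a : ℝ := A.card / N with ha
  have ha0 : 0 ≤ a := by positivity
  have ha1 : a ≤ 1 := by
    rw [ha, div_le_one hNpos, hN]; exact_mod_cast A.card_le_univ
  let f : G → ℝ := fun g => (if g ∈ A then 1 else 0) - a
  have hfsum : ∑ g, f g = 0 := by
    simp only [f, Finset.sum_sub_distrib, Finset.sum_boole, Finset.sum_const, Finset.card_univ,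
      nsmul_eq_mul, Finset.filter_univ_mem, ← hN, ha]
    field_simp
    ring
  have hfsq : ∑ g, f g ^ 2 ≤ N := by
    calc ∑ g, f g ^ 2 ≤ ∑ _g : G, (1 : ℝ) := by
          refine Finset.sum_le_sum fun g _ => ?_
          simp only [f]
          split_ifs <;> nlinarith
      _ = N := by simp [hN]
  let F : ι → G → ℝ := fun i x =>
    (((B i).filter fun g => g⁻¹ * x ∈ A).card : ℝ) - a * (B i).card
  have hF : ∀ i, D * ∑ x, F i x ^ 2 ≤ N ^ 3 := by
    intro i
    have h1 := IsSimpleGroup.mul_sum_sq_convolution_le hG hD f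
      (fun g => if g ∈ B i then 1 else 0) hfsum
    have h2 : ∀ x, ∑ g, f (g⁻¹ * x) * (if g ∈ B i then 1 else 0) = F i x := by
      intro x
      simp only [f, F, mul_ite, mul_one, mul_zero, Finset.sum_ite_mem, Finset.univ_inter,
        Finset.sum_sub_distrib, Finset.sum_boole, Finset.sum_const, nsmul_eq_mul]
      ring
    have h3 : ∑ g, (if g ∈ B i then (1 : ℝ) else 0) ^ 2 ≤ N := by
      simp only [ite_pow, one_pow, ne_eq, OfNat.ofNat_ne_zero, not_false_eq_true, zero_pow,
        Finset.sum_boole, Finset.filter_univ_mem, hN]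
      exact_mod_cast Finset.card_le_univ _
    simp only [h2] at h1
    refine h1.trans ?_
    calc N * (∑ g, f g ^ 2) * ∑ g, (if g ∈ B i then (1 : ℝ) else 0) ^ 2 ≤ N * N * N := by
          gcongr
      _ = N ^ 3 := by ring
  -- Second moment: averaging over `x` yields one point good for all `i` at once.
  have hsum : ∑ x, D * ∑ i ∈ I, F i x ^ 2 ≤ ∑ _x : G, I.card * N ^ 2 := by
    rw [← Finset.mul_sum, Finset.sum_comm, Finset.mul_sum]
    calc ∑ i ∈ I, D * ∑ x, F i x ^ 2 ≤ ∑ _i ∈ I, N ^ 3 := Finset.sum_le_sum fun i _ => hF i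
      _ = ∑ _x : G, I.card * N ^ 2 := by
          simp only [Finset.sum_const, Finset.card_univ, nsmul_eq_mul, ← hN]
          ring
  obtain ⟨x, -, hx⟩ := Finset.exists_le_of_sum_le Finset.univ_nonempty hsum
  refine ⟨x, fun i hi => ?_⟩
  change |F i x| ≤ η * N
  refine abs_le_of_sq_le_sq ?_ (by positivity)
  have h1 : F i x ^ 2 ≤ ∑ i ∈ I, F i x ^ 2 :=
    Finset.single_le_sum (f := fun i => F i x ^ 2) (fun i _ => sq_nonneg _) hi
  have hD' : (0 : ℝ) < D := by exact_mod_cast hDpos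
  refine le_of_mul_le_mul_left ?_ hD'
  calc D * F i x ^ 2 ≤ D * ∑ i ∈ I, F i x ^ 2 := by gcongr
    _ ≤ I.card * N ^ 2 := hx
    _ ≤ D * η ^ 2 * N ^ 2 := by gcongr
    _ = D * (η * N) ^ 2 := by ring

/-- There are sets `X` of each size `k ≤ m` all of whose subsets are cut out on `X` by many left
translates of `A`. -/
theorem IsSimpleGroup.exists_card_eq_forall_subset_le_card {G : Type*} [Group G] [Fintype G]
    [DecidableEq G] [IsSimpleGroup G] (hG : ∃ a b : G, a * b ≠ b * a) {D m : ℕ}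
    (hD : 5 ^ D ^ 2 < Fintype.card G) {ε : ℝ} (hε : 0 < ε) (hε1 : ε ≤ 1)
    (hDm : (2 : ℝ) ^ m ≤ D * ((ε / 2) ^ m) ^ 2) (A : Finset G)
    (hA : ε * Fintype.card G ≤ A.card) (hA' : (A.card : ℝ) ≤ (1 - ε) * Fintype.card G) :
    ∀ k ≤ m, ∃ X : Finset G, X.card = k ∧ ∀ S ⊆ X, (ε / 2) ^ k * Fintype.card G ≤
      ((Finset.univ.filter fun g : G => ∀ x ∈ X, g⁻¹ * x ∈ A ↔ x ∈ S).card : ℝ) := by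
  intro k
  have hNpos : (0 : ℝ) < Fintype.card G := by exact_mod_cast Fintype.card_pos
  induction k with
  | zero => exact fun _ => ⟨∅, rfl, fun S _ => by simp⟩
  | succ k ih =>
    intro hk
    obtain ⟨X, hXk, hX⟩ := ih (by omega)
    set B : Finset G → Finset G := fun S =>
      Finset.univ.filter fun g : G => ∀ x ∈ X, g⁻¹ * x ∈ A ↔ x ∈ S with hB
    have hη : (X.powerset.card : ℝ) ≤ D * ((ε / 2) ^ (k + 1)) ^ 2 := by
      rw [Finset.card_powerset, hXk, Nat.cast_pow, Nat.cast_ofNat]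
      calc (2 : ℝ) ^ k ≤ 2 ^ m := by gcongr <;> [norm_num; omega]
        _ ≤ D * ((ε / 2) ^ m) ^ 2 := hDm
        _ ≤ D * ((ε / 2) ^ (k + 1)) ^ 2 := by
          have := pow_le_pow_of_le_one (by positivity : 0 ≤ ε / 2) (by linarith) hk
          gcongr
    obtain ⟨x, hx⟩ := IsSimpleGroup.exists_forall_abs_card_sub_le hG hD A X.powerset B
      (by positivity) hη
    -- The expected size is at least `ε * (ε / 2) ^ k * |G|`, twice the error allowed, so half of it
    -- survives; `hout` is the same for the complement.
    have hin : ∀ S ⊆ X, (ε / 2) ^ (k + 1) * Fintype.card G ≤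
        (((B S).filter fun g => g⁻¹ * x ∈ A).card : ℝ) := by
      intro S hS
      have h1 := (abs_le.1 (hx S (Finset.mem_powerset.2 hS))).1
      have h2 : ε * (B S).card ≤ A.card / Fintype.card G * (B S).card := by
        gcongr
        rwa [le_div_iff₀ hNpos]
      have h3 := mul_le_mul_of_nonneg_left (hX S hS) hε.le
      rw [pow_succ] at h1 ⊢
      nlinarith
    have hout : ∀ S ⊆ X, (ε / 2) ^ (k + 1) * Fintype.card G ≤
        (((B S).filter fun g => g⁻¹ * x ∉ A).card : ℝ) := by
      intro S hS
      have h1 := (abs_le.1 (hx S (Finset.mem_powerset.2 hS))).2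
      have h2 : A.card / Fintype.card G * ((B S).card : ℝ) ≤ (1 - ε) * (B S).card := by
        gcongr
        rwa [div_le_iff₀ hNpos]
      have h3 := mul_le_mul_of_nonneg_left (hX S hS) hε.le
      have h4 : (((B S).filter fun g => g⁻¹ * x ∈ A).card : ℝ) +
          ((B S).filter fun g => g⁻¹ * x ∉ A).card = (B S).card := by
        exact_mod_cast Finset.card_filter_add_card_filter_not (s := B S) _
      rw [pow_succ] at h1 ⊢
      nlinarith
    -- Translates missing all of `X` would also miss `x`, contradicting `hin ∅`.
    have hxX : x ∉ X := by
      intro hxX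
      have h1 := hin ∅ (Finset.empty_subset _)
      have h2 : (B ∅).filter (fun g => g⁻¹ * x ∈ A) = ∅ := by
        refine Finset.filter_eq_empty_iff.2 fun g hg hgA => ?_
        have := ((Finset.mem_filter.1 hg).2 x hxX).1 hgA
        simp at this
      rw [h2, Finset.card_empty, Nat.cast_zero] at h1
      have : 0 < (ε / 2) ^ (k + 1) * (Fintype.card G : ℝ) := by positivity
      linarith
    refine ⟨insert x X, by rw [Finset.card_insert_of_notMem hxX, hXk], fun S hS => ?_⟩
    have hSX : S.erase x ⊆ X := Finset.subset_insert_iff.1 hS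
    have hmem : ∀ g ∈ B (S.erase x), ∀ y ∈ X, (g⁻¹ * y ∈ A ↔ y ∈ S) := by
      intro g hg y hy
      rw [(Finset.mem_filter.1 hg).2 y hy, Finset.mem_erase]
      exact and_iff_right (fun h => hxX (h ▸ hy))
    by_cases hxS : x ∈ S
    · refine (hin _ hSX).trans (Nat.cast_le.2 (Finset.card_le_card fun g hg => ?_))
      obtain ⟨hg, hgx⟩ := Finset.mem_filter.1 hg
      refine Finset.mem_filter.2 ⟨Finset.mem_univ _, fun y hy => ?_⟩
      rcases Finset.mem_insert.1 hy with rfl | hy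
      · exact iff_of_true hgx hxS
      · exact hmem g hg y hy
    · refine (hout _ hSX).trans (Nat.cast_le.2 (Finset.card_le_card fun g hg => ?_))
      obtain ⟨hg, hgx⟩ := Finset.mem_filter.1 hg
      refine Finset.mem_filter.2 ⟨Finset.mem_univ _, fun y hy => ?_⟩
      rcases Finset.mem_insert.1 hy with rfl | hy
      · exact iff_of_false hgx hxS
      · exact hmem g hg y hy

theorem corollary7p4 (d : ℤ) (ε : ℝ) (hε : 0 < ε) :
    ∃ n : ℕ, ∀ (G : Type*) [Group G] [Fintype G] [DecidableEq G] [IsSimpleGroup G],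
      (∃ a b : G, a * b ≠ b * a) → n < Fintype.card G →
      ∀ A : Finset G, (groupVCDim A : ℤ) ≤ d →
        (A.card : ℝ) ≤ ε * (Fintype.card G : ℝ) ∨
          (1 - ε) * (Fintype.card G : ℝ) ≤ (A.card : ℝ) := by
  -- For negative `d` the hypothesis on `A` is never satisfied, so truncating at 0 is harmless.
  set m := d.toNat + 1 with hm
  -- At most `2 ^ m` traces are controlled at once, with error no finer than `(ε / 2) ^ m`.
  obtain ⟨D, hD⟩ := exists_nat_ge ((2 : ℝ) ^ m / ((ε / 2) ^ m) ^ 2)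
  rw [div_le_iff₀ (by positivity)] at hD
  refine ⟨5 ^ D ^ 2, fun G _ _ _ _ hG hn A hA => ?_⟩
  by_contra! hcon
  obtain ⟨h1, h2⟩ := hcon
  have hε1 : ε ≤ 1 := by
    have hle : (A.card : ℝ) ≤ Fintype.card G := by exact_mod_cast A.card_le_univ
    by_contra! hlt
    nlinarith [(Nat.cast_nonneg A.card : (0 : ℝ) ≤ A.card)]
  obtain ⟨X, hXm, hX⟩ := IsSimpleGroup.exists_card_eq_forall_subset_le_card hG hn hε hε1 hD A
    h1.le h2.le m le_rfl
  have hsh : (leftTranslates A).Shatters X := by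
    intro S hS
    have hpos : (0 : ℝ) < (ε / 2) ^ m * Fintype.card G := by
      have : (0 : ℝ) < Fintype.card G := by exact_mod_cast Fintype.card_pos
      positivity
    obtain ⟨g, hg⟩ := Finset.card_pos.1 (Nat.cast_pos.1 (hpos.trans_le (hX S hS)))
    refine ⟨_, Finset.mem_image_of_mem _ (Finset.mem_univ g), ?_⟩
    ext x
    rw [Finset.mem_inter, ← Finset.inv_smul_mem_iff, smul_eq_mul]
    constructor
    · rintro ⟨hx, hxA⟩
      exact ((Finset.mem_filter.1 hg).2 x hx).1 hxA
    · intro hx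
      exact ⟨hS hx, ((Finset.mem_filter.1 hg).2 x (hS hx)).2 hx⟩
  have hle : m ≤ groupVCDim A := hXm ▸ hsh.card_le_vcDim
  omega
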